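/- Let $\sigma'\mathbb{Q}$ be the set of all well-ordered subsets of $\mathbb{Q}$ that have a maximum, ordered by end extension; it is a tree. For a point $t$ of a tree, its height $\mathrm{ht}(t)$ is the order type of the set of predecessors of $t$, and for $\xi<\mathrm{ht}(t)$ we write $t\restriction\xi$ for the predecessor of $t$ of height $\xi$. A \emph{subtree} of a tree $T$ is a nonempty downward closed set $S\subseteq T$ such that every $s\in S$ has extensions in $S$ of arbitrarily large height below $\omega_1$. An \emph{Aronszajn tree} is a tree of height $\omega_1$ with countable levels and no uncountable chains; a tree is \emph{special} if it is the union of countably many antichains. A \emph{ladder system} is a sequence $\mathbf{C}=(C_\alpha)$, indexed by the limit ordinals $0<\alpha<\omega_1$, where $C_\alpha\subseteq\alpha$ is cofinal in $\alpha$ and has order type $\omega$. A \emph{monochromatic $\omega$-colouring} of $\mathbf{C}$ is a sequence $\mathbf{f}=(f_\alpha)$ of constant maps $f_\alpha:C_\alpha\to\omega$. A \emph{$T$-uniformization} of $\mathbf{f}$ is a map $\varphi:S\to\omega$ on a subtree $S$ of $T$ such that for every $s\in S$ of limit height $\alpha$ we have $\varphi(s\restriction\xi)=f_\alpha(\xi)$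 for all but finitely many $\xi\in C_\alpha$. The principle $\diamondsuit^+$ says that there is a sequence $(W_\alpha)_{\alpha<\omega_1}$ of countable sets such that for every $X\subseteq\omega_1$ there is a closed unbounded $D\subseteq\omega_1$ with $X\cap\alpha\in W_\alpha$ and $D\cap\alpha\in W_\alpha$ for all $\alpha\in D$. \textbf{Theorem.} Assume $\diamondsuit^+$. Then for every ladder system $\mathbf{C}$ there is a subtree $T$ of $\sigma'\mathbb{Q}$ which is a special Aronszajn tree and such that every monochromatic $\omega$-colouring of $\mathbf{C}$ has a $T$-uniformization. -/

import Mathlib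

namespace LadderUnif

/-! ### Countable ordinals, the diamond-plus principle, ladder systems -/

/-- The ordinal `ω₁`, as the linearly ordered type of all countable ordinals. -/
abbrev Omega1 : Type 1 := Set.Iio (Ordinal.omega 1 : Ordinal.{0})

/-- The countable limit ordinals (zero is not a limit). -/
abbrev LimOmega1 : Type 1 := {α : Omega1 // Order.IsSuccLimit α}

/-- The principle diamond-plus: there are countable families `W α`, `α < ω₁`, such that for each
`X ⊆ ω₁` some closed unbounded `D ⊆ ω₁` satisfies `X ∩ α ∈ W α` and `D ∩ α ∈ W α` for all
`α ∈ D`. -/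
def DiamondPlus : Prop :=
  ∃ W : Omega1 → Set (Set Omega1), (∀ α, (W α).Countable) ∧
    ∀ X : Set Omega1, ∃ D : Set Omega1, IsClub D ∧
      ∀ α ∈ D, X ∩ Set.Iio α ∈ W α ∧ D ∩ Set.Iio α ∈ W α

/-- A ladder system on `ω₁`: a cofinal subset of order type `ω` of each countable limit ordinal. -/
structure LadderSystem where
  ladder : LimOmega1 → Set Omega1
  lt_of_mem : ∀ α, ∀ ξ ∈ ladder α, ξ < α.1
  cofinal : ∀ α, ∀ β < α.1, ∃ ξ ∈ ladder α, β ≤ ξ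
  type_omega : ∀ α, Nonempty (ℕ ≃o ladder α)

/-- An `ω`-colouring of a ladder system: a map from each ladder to `ω`. -/
abbrev LadderSystem.Colouring (C : LadderSystem) : Type 1 :=
  ∀ α : LimOmega1, C.ladder α → ℕ

/-- A colouring is monochromatic if it is constant on each ladder. -/
def LadderSystem.Colouring.Monochromatic {C : LadderSystem} (f : C.Colouring) : Prop :=
  ∀ α, ∃ n, ∀ ξ, f α ξ = n

/-! ### Trees -/

/-- A tree is a partial order in which the set of predecessors of each point is well ordered. -/
class IsTree (P : Type) [PartialOrder P] : Prop where
  isWellOrder : ∀ t : P, IsWellOrder (Set.Iio t) (· < ·)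

instance (P : Type) [PartialOrder P] [IsTree P] (t : P) : IsWellOrder (Set.Iio t) (· < ·) :=
  IsTree.isWellOrder t

/-- A subset of a tree is a tree with the induced order. -/
instance (P : Type) [PartialOrder P] [IsTree P] (T : Set P) : IsTree T where
  isWellOrder t := by
    let e : Set.Iio t → Set.Iio (t : P) := fun s => ⟨s.1.1, s.2⟩
    have he : Function.Injective e := fun a b h =>
      Subtype.ext (Subtype.ext (congrArg (fun x : Set.Iio (t : P) => (x : P)) h))
    exact RelEmbedding.isWellOrder (s := ((· < ·) : Set.Iio (t : P) → Set.Iio (t : P) → Prop))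
      ⟨⟨e, he⟩, Iff.rfl⟩

/-- The height of a point `t` of a tree: the order type of the set of its predecessors. -/
noncomputable def height {P : Type} [PartialOrder P] [IsTree P] (t : P) : Ordinal.{0} :=
  Ordinal.type ((· < ·) : Set.Iio t → Set.Iio t → Prop)

/-- The level `α` of a tree. -/
def level (P : Type) [PartialOrder P] [IsTree P] (α : Ordinal.{0}) : Set P :=
  {t | height t = α}

/-- An Aronszajn tree: a tree of height `ω₁` with countable levels and no uncountable chains. -/
structure IsAronszajn (P : Type) [PartialOrder P] [IsTree P] : Prop where
  level_nonempty_iff : ∀ α, (level P α).Nonempty ↔ α < Ordinal.omega 1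
  level_countable : ∀ α, (level P α).Countable
  chain_countable : ∀ c : Set P, IsChain (· ≤ ·) c → c.Countable

/-- A tree is special if it is a union of countably many antichains. -/
def IsSpecial (P : Type) [PartialOrder P] : Prop :=
  ∃ A : ℕ → Set P, (∀ n, IsAntichain (· ≤ ·) (A n)) ∧ ⋃ n, A n = Set.univ

/-- A subtree of a tree of height `ω₁`: nonempty, downward closed and pruned, i.e. each of its
points has extensions in it of arbitrarily large countable height. -/
structure IsSubtree {P : Type} [PartialOrder P] [IsTree P] (S : Set P) : Prop where
  nonempty : S.Nonempty
  isLowerSet : IsLowerSet S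
  pruned : ∀ s ∈ S, ∀ β < Ordinal.omega 1, ∃ t ∈ S, s ≤ t ∧ β ≤ height t

/-- `φ`, defined on a set `S` of points of the tree `P`, uniformizes the colouring `f`: if `s ∈ S`
has limit height `α < ω₁` then for all but finitely many `ξ` in the ladder at `α`, the value of `φ`
at the predecessor of `s` of height `ξ` is `f α ξ`. -/
def Uniformizes {P : Type} [PartialOrder P] [IsTree P] {C : LadderSystem} (f : C.Colouring)
    (S : Set P) (φ : S → ℕ) : Prop :=
  ∀ s : S, ∀ α : LimOmega1, height (s : P) = α.1.1 →
    {ξ : C.ladder α | ¬ ∃ u : S, u < s ∧ height (u : P) = ξ.1.1 ∧ φ u = f α ξ}.Finite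

/-- `f` has a `P`-uniformization: a map on some subtree of `P` that uniformizes `f`. -/
def HasUniformization (P : Type) [PartialOrder P] [IsTree P] {C : LadderSystem}
    (f : C.Colouring) : Prop :=
  ∃ (S : Set P) (φ : S → ℕ), IsSubtree S ∧ Uniformizes f S φ

/-! ### The tree of well-ordered sets of rationals with a maximum -/

/-- The well-ordered sets of rational numbers that have a maximum. -/
@[ext]
structure SigmaPrimeQ : Type where
  carrier : Set ℚ
  isWF : carrier.IsWF
  hasMax : ∃ m, IsGreatest carrier m

namespace SigmaPrimeQ

/-- The order of end extension. -/
instance : PartialOrder SigmaPrimeQ where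
  le s t := s.carrier ⊆ t.carrier ∧ ∀ x ∈ t.carrier, x ∉ s.carrier → ∀ y ∈ s.carrier, y < x
  le_refl s := ⟨subset_rfl, fun _ h h' => absurd h h'⟩
  le_trans s t u hst htu := by
    refine ⟨hst.1.trans htu.1, fun x hx hxs y hy => ?_⟩
    by_cases hxt : x ∈ t.carrier
    · exact hst.2 x hxt hxs y hy
    · exact htu.2 x hx hxt y (hst.1 hy)
  le_antisymm s t hst hts := SigmaPrimeQ.ext (hst.1.antisymm hts.1)

theorem le_def (s t : SigmaPrimeQ) : s ≤ t ↔
    s.carrier ⊆ t.carrier ∧ ∀ x ∈ t.carrier, x ∉ s.carrier → ∀ y ∈ s.carrier, y < x := Iff.rfl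

/-- The maximum of a point. -/
noncomputable def max (s : SigmaPrimeQ) : ℚ := s.hasMax.choose

theorem isGreatest_max (s : SigmaPrimeQ) : IsGreatest s.carrier s.max := s.hasMax.choose_spec

/-- A point below `t` is the set of elements of `t` up to its own maximum. -/
theorem mem_iff_of_le {s t : SigmaPrimeQ} (h : s ≤ t) (x : ℚ) :
    x ∈ s.carrier ↔ x ∈ t.carrier ∧ x ≤ s.max := by
  refine ⟨fun hx => ⟨h.1 hx, s.isGreatest_max.2 hx⟩, fun hx => ?_⟩
  by_contra hxs
  exact absurd hx.2 (not_le.2 (h.2 x hx.1 hxs _ s.isGreatest_max.1))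

theorem lt_iff_of_le {a b t : SigmaPrimeQ} (ha : a ≤ t) (hb : b ≤ t) : a < b ↔ a.max < b.max := by
  have key : ∀ {a b : SigmaPrimeQ}, a ≤ t → b ≤ t → a.max ≤ b.max → a ≤ b := by
    intro a b ha hb hab
    refine ⟨fun x hx => ?_, fun x hx hxa y hy => ?_⟩
    · rw [mem_iff_of_le ha] at hx
      exact (mem_iff_of_le hb x).2 ⟨hx.1, hx.2.trans hab⟩
    · exact ha.2 x (hb.1 hx) hxa y hy
  rw [lt_iff_le_not_ge]
  constructor
  · rintro ⟨-, h⟩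
    by_contra h'
    exact h (key hb ha (not_lt.1 h'))
  · intro h
    exact ⟨key ha hb h.le, fun h' => absurd (b.isGreatest_max.1) (fun hm =>
      absurd (a.isGreatest_max.2 (h'.1 hm)) (not_le.2 h))⟩

instance : IsTree SigmaPrimeQ where
  isWellOrder t := by
    have : IsWellOrder t.carrier (· < ·) :=
      { wf := t.isWF
        trichotomous := fun a b h h' => le_antisymm (not_lt.1 h') (not_lt.1 h) }
    let e : Set.Iio t → t.carrier := fun s => ⟨s.1.max, (show s.1 ≤ t from le_of_lt s.2).1 s.1.isGreatest_max.1⟩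
    have he : Function.Injective e := by
      intro a b h
      have h : a.1.max = b.1.max := congrArg Subtype.val h
      refine Subtype.ext (SigmaPrimeQ.ext (Set.ext fun x => ?_))
      rw [mem_iff_of_le (le_of_lt a.2), mem_iff_of_le (le_of_lt b.2), h]
    exact RelEmbedding.isWellOrder (s := ((· < ·) : t.carrier → t.carrier → Prop))
      ⟨⟨e, he⟩, fun {a b} => (lt_iff_of_le (le_of_lt a.2) (le_of_lt b.2)).symm⟩

end SigmaPrimeQ

end LadderUnif

namespace LadderUnif

/-! ### Heights in trees -/

section Height

variable {P : Type} [PartialOrder P] [IsTree P]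

/-! The tree is built level by level. For each of countably many requirements `Q` at level `α`, each
earlier point `s` and each rational `r`, one point above `s` with maximum `r` lying in `Q` is added,
if there is one. Levels stay countable, and `max` is strictly increasing into the rationals, so the
tree is special. Since the trivial requirement is always included, every point extends to every
greater height with every greater maximum (`exists_extension`).

Given constants `g` coded by `X`, let `D` be the club from diamond-plus. Colour levels in `D` by a
dense colouring of the maximum, and levels in a gap of `D` by a canonically chosen good colouring up
to the next element of `D` (`exists_isGood`). Below an accumulation point `α` of `D` this colouring
depends only on `X ∩ α`, `D ∩ α` and the tree below `α` (`treeColor_congr`), and both sets are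
guessed at `α`. The colour at `α` itself is one natural number, so "the colouring uniformizes up to
`α`" is among the countably many requirements there; this is where monochromaticity matters.

The points where the colouring succeeds form the required subtree. They can be extended to every
level (`exists_mem_uniformPart`): across gaps because the chosen pieces are good, and at
accumulation points because a branch taking the right colours along the ladder exists
(`exists_branch`), so the tree contains a point meeting the same requirement. -/

theorem height_eq_typein {s t : P} (h : s < t) :
    height s = Ordinal.typein ((· < ·) : Set.Iio t → Set.Iio t → Prop) ⟨s, h⟩ := by
  rw [← Ordinal.type_subrel]
  refine Ordinal.type_eq.2 ⟨⟨⟨fun u => ⟨⟨u.1, u.2.trans h⟩, u.2⟩, fun u => ⟨u.1.1, u.2⟩,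
    fun _ => rfl, fun _ => rfl⟩, Iff.rfl⟩⟩

theorem height_lt_height {s t : P} (h : s < t) : height s < height t := by
  rw [height_eq_typein h]
  exact Ordinal.typein_lt_type _ _

theorem height_le_height {s t : P} (h : s ≤ t) : height s ≤ height t := by
  rcases h.eq_or_lt with rfl | h
  · exact le_rfl
  · exact (height_lt_height h).le

theorem exists_lt_height_eq {t : P} {ξ : Ordinal.{0}} (h : ξ < height t) :
    ∃ u < t, height u = ξ := by
  obtain ⟨u, hu⟩ := Ordinal.typein_surj _ h
  exact ⟨u.1, u.2, (height_eq_typein u.2).trans hu⟩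

theorem lt_trichotomy_of_le {u v t : P} (hu : u ≤ t) (hv : v ≤ t) : u < v ∨ u = v ∨ v < u := by
  rcases hu.eq_or_lt with rfl | hu
  · exact Or.inr (hv.eq_or_lt.imp Eq.symm id)
  rcases hv.eq_or_lt with rfl | hv
  · exact Or.inl hu
  have := trichotomous_of ((· < ·) : Set.Iio t → Set.Iio t → Prop) ⟨u, hu⟩ ⟨v, hv⟩
  simpa [← Subtype.coe_lt_coe, Subtype.ext_iff] using this

theorem eq_of_height_eq {u v t : P} (hu : u ≤ t) (hv : v ≤ t) (h : height u = height v) :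
    u = v := by
  rcases lt_trichotomy_of_le hu hv with h' | h' | h'
  · exact absurd h (height_lt_height h').ne
  · exact h'
  · exact absurd h (height_lt_height h').ne'

theorem lt_of_height_lt {u v t : P} (hu : u ≤ t) (hv : v ≤ t) (h : height u < height v) :
    u < v := by
  rcases lt_trichotomy_of_le hu hv with h' | h' | h'
  · exact h'
  · exact absurd (h' ▸ h) (lt_irrefl _)
  · exact absurd h (height_lt_height h').not_gt

theorem height_coe {T : Set P} (hT : IsLowerSet T) (t : T) : height (t : P) = height t :=
  Ordinal.type_eq.2 ⟨⟨⟨fun u => ⟨⟨u.1, hT (le_of_lt u.2) t.2⟩, u.2⟩, fun u => ⟨u.1.1, u.2⟩,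
    fun _ => rfl, fun _ => rfl⟩, Iff.rfl⟩⟩

end Height

/-! ### Countable ordinals -/

namespace Omega1

theorem countable_Iio (α : Omega1) : (Set.Iio α).Countable := by
  have h : (Set.Iio α.1).Countable := by
    rw [← Cardinal.le_aleph0_iff_set_countable, Cardinal.mk_Iio_ordinal,
      Cardinal.lift_le_aleph0, ← Order.lt_succ_iff]
    have := α.2
    rwa [Set.mem_Iio, Cardinal.lt_omega_iff_card_lt, ← Cardinal.succ_aleph0] at this
  exact h.preimage_of_injOn (f := Subtype.val) Subtype.val_injective.injOn

theorem countable_Iic (α : Omega1) : (Set.Iic α).Countable := by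
  rw [← Set.Iio_insert]
  exact (countable_Iio α).insert _

/-- The ordinal `α + n` as a countable ordinal. -/
noncomputable def addNat (α : Omega1) (n : ℕ) : Omega1 :=
  ⟨α.1 + n, (Cardinal.isSuccLimit_omega 1).add_natCast_lt α.2 n⟩

theorem addNat_lt {α β : Omega1} (hα : Order.IsSuccLimit α) (h : β < α) (n : ℕ) :
    addNat β n < α := by
  induction n with
  | zero => simpa [addNat, ← Subtype.coe_lt_coe] using h
  | succ n ih =>
    by_contra hcon
    refine hα.isSuccPrelimit (addNat β n) ⟨ih, fun x hx hxα => hcon (lt_of_le_of_lt ?_ hxα)⟩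
    have hx : β.1 + n < x.1 := hx
    change β.1 + (n + 1 : ℕ) ≤ x.1
    rw [Nat.cast_add, Nat.cast_one, ← add_assoc]
    exact Order.add_one_le_of_lt hx

/-- Cancelling successors on both sides would otherwise leave a limit equal to a successor. This
makes the coding of colourings by sets unambiguous. -/
theorem addNat_inj {α β : Omega1} (hα : Order.IsSuccLimit α) (hβ : Order.IsSuccLimit β)
    {m n : ℕ} (h : addNat α m = addNat β n) : m = n := by
  have key : ∀ {α β : Omega1} (_ : Order.IsSuccLimit α) (n : ℕ),
      addNat α 0 ≠ addNat β (n + 1) := by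
    intro α β hα n h
    have h0 : addNat α 0 = α := Subtype.ext (by simp [addNat])
    rw [h0] at h
    have hlt : β < α := by
      rw [h, ← Subtype.coe_lt_coe]
      exact lt_add_of_pos_right _ (by simp)
    exact (addNat_lt hα hlt (n + 1)).ne h.symm
  induction m generalizing n with
  | zero =>
    cases n with
    | zero => rfl
    | succ n => exact absurd h (key hα n)
  | succ m ih =>
    cases n with
    | zero => exact absurd h.symm (key hβ m)
    | succ n =>
      refine congrArg _ (ih (Subtype.ext ?_))
      have h := congrArg Subtype.val h
      simp only [addNat, Nat.cast_add, Nat.cast_one, ← add_assoc] at h ⊢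
      exact Order.succ_injective (by simpa using h)

theorem exists_covBy_or_isSuccLimit {α : Omega1} (h : ¬ IsMin α) :
    (∃ β, β ⋖ α) ∨ Order.IsSuccLimit α := by
  by_cases h' : ∃ β, β ⋖ α
  · exact Or.inl h'
  · exact Or.inr ⟨h, fun β hβ => h' ⟨β, hβ⟩⟩

end Omega1

/-! ### Heights, upper bounds and minimal points in the tree of well-ordered sets of rationals. -/

namespace SigmaPrimeQ

theorem countable_Iio (t : SigmaPrimeQ) : (Set.Iio t).Countable := by
  have h : Set.InjOn max (Set.Iio t) := fun a ha b hb hab => by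
    refine SigmaPrimeQ.ext (Set.ext fun x => ?_)
    rw [mem_iff_of_le (le_of_lt ha), mem_iff_of_le (le_of_lt hb), hab]
  exact Set.countable_of_injective_of_countable_image h (Set.to_countable _)

/-- The height of a point, as a countable ordinal. -/
noncomputable def ht (t : SigmaPrimeQ) : Omega1 :=
  ⟨height t, by
    rw [Set.mem_Iio, Cardinal.lt_omega_iff_card_lt, ← Cardinal.succ_aleph0, Order.lt_succ_iff,
      height, Ordinal.card_type]
    exact Cardinal.le_aleph0_iff_set_countable.2 t.countable_Iio⟩

variable {s t u v : SigmaPrimeQ} {α : Omega1}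

theorem ht_lt_ht (h : s < t) : ht s < ht t := height_lt_height h

theorem ht_le_ht (h : s ≤ t) : ht s ≤ ht t := height_le_height h

theorem exists_lt_ht_eq {ξ : Omega1} (h : ξ < ht t) : ∃ u < t, ht u = ξ := by
  obtain ⟨u, hu, h⟩ := exists_lt_height_eq (t := t) (ξ := ξ.1) h
  exact ⟨u, hu, Subtype.ext h⟩

theorem exists_le_ht_eq {ξ : Omega1} (h : ξ ≤ ht t) : ∃ u ≤ t, ht u = ξ := by
  rcases h.eq_or_lt with h | h
  · exact ⟨t, le_rfl, h.symm⟩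
  · obtain ⟨u, hu, h⟩ := exists_lt_ht_eq h
    exact ⟨u, hu.le, h⟩

theorem eq_of_ht_eq (hu : u ≤ t) (hv : v ≤ t) (h : ht u = ht v) : u = v :=
  eq_of_height_eq hu hv (congrArg Subtype.val h)

theorem lt_of_ht_lt (hu : u ≤ t) (hv : v ≤ t) (h : ht u < ht v) : u < v :=
  lt_of_height_lt hu hv h

theorem ht_eq_of (h₁ : ∀ u < t, ht u < α) (h₂ : ∀ ξ < α, ∃ u < t, ξ ≤ ht u) : ht t = α := by
  rcases lt_trichotomy (ht t) α with h | h | h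
  · obtain ⟨u, hu, hle⟩ := h₂ _ h
    exact absurd (ht_lt_ht hu) hle.not_gt
  · exact h
  · obtain ⟨u, hu, rfl⟩ := exists_lt_ht_eq h
    exact absurd (h₁ u hu) (lt_irrefl _)

theorem max_lt_max (h : s < t) : s.max < t.max := (lt_iff_of_le h.le le_rfl).1 h

theorem le_of_max_le (hu : u ≤ t) (hv : v ≤ t) (h : u.max ≤ v.max) : u ≤ v := by
  rcases lt_trichotomy_of_le hu hv with h' | h' | h'
  · exact h'.le
  · exact h'.le
  · exact absurd (max_lt_max h') h.not_gt

theorem max_eq {q : ℚ} (h : IsGreatest t.carrier q) : t.max = q :=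
  t.isGreatest_max.unique h

/-- An increasing sequence whose maxima are below `r` has an upper bound with maximum `r`, all of
whose predecessors lie below some term of the sequence. -/
theorem exists_upper_bound {s : ℕ → SigmaPrimeQ} (hs : Monotone s) {r : ℚ}
    (hr : ∀ k, (s k).max < r) :
    ∃ t : SigmaPrimeQ, t.max = r ∧ (∀ k, s k < t) ∧ ∀ u < t, ∃ k, u ≤ s k := by
  have hmem : ∀ {j k : ℕ} {x : ℚ}, x ∈ (s j).carrier → x ≤ (s k).max → x ∈ (s k).carrier := by
    intro j k x hx hxk
    rcases le_total j k with h | h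
    · exact (hs h).1 hx
    · exact (mem_iff_of_le (hs h) x).2 ⟨hx, hxk⟩
  have hwf : (⋃ k, (s k).carrier).IsWF := by
    rw [Set.isWF_iff_no_descending_seq]
    intro f hf hmemf
    -- A descending sequence that starts in `s k` stays below its maximum, hence inside `s k` by
    -- `hmem`.
    obtain ⟨k, hk⟩ := Set.mem_iUnion.1 (hmemf 0)
    refine Set.isWF_iff_no_descending_seq.1 (s k).isWF f hf fun n => ?_
    obtain ⟨j, hj⟩ := Set.mem_iUnion.1 (hmemf n)
    exact hmem hj ((hf.antitone (Nat.zero_le n)).trans ((s k).isGreatest_max.2 hk))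
  have hlt : ∀ x ∈ ⋃ k, (s k).carrier, x < r := fun x hx => by
    obtain ⟨k, hk⟩ := Set.mem_iUnion.1 hx
    exact ((s k).isGreatest_max.2 hk).trans_lt (hr k)
  have hgr : IsGreatest (insert r (⋃ k, (s k).carrier)) r :=
    ⟨Set.mem_insert _ _, fun x hx => hx.elim (fun h => h.le) fun h => (hlt x h).le⟩
  let t : SigmaPrimeQ := ⟨insert r (⋃ k, (s k).carrier), hwf.insert r, r, hgr⟩
  have ht : t.max = r := max_eq hgr
  have hle : ∀ k, s k ≤ t := fun k =>
    ⟨fun x hx => Or.inr (Set.mem_iUnion.2 ⟨k, hx⟩), fun x hx hxk y hy => by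
      rcases hx with rfl | hx
      · exact hlt y (Set.mem_iUnion.2 ⟨k, hy⟩)
      · obtain ⟨j, hj⟩ := Set.mem_iUnion.1 hx
        by_contra hcon
        exact hxk (hmem hj ((not_lt.1 hcon).trans ((s k).isGreatest_max.2 hy)))⟩
  refine ⟨t, ht, fun k => (lt_iff_of_le (hle k) le_rfl).2 (by rw [ht]; exact hr k),
    fun u hu => ?_⟩
  rcases hu.le.1 u.isGreatest_max.1 with h | h
  · exact absurd (max_lt_max hu) (by rw [h, ht]; exact lt_irrefl _)
  · obtain ⟨k, hk⟩ := Set.mem_iUnion.1 h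
    exact ⟨k, le_of_max_le hu.le (hle k) ((s k).isGreatest_max.2 hk)⟩

/-- The point `{q}`. -/
def singleton (q : ℚ) : SigmaPrimeQ := ⟨{q}, Set.isWF_singleton, q, isGreatest_singleton⟩

theorem ht_singleton (q : ℚ) : IsMin (ht (singleton q)) := by
  intro β hβ
  by_contra hcon
  obtain ⟨u, hu, -⟩ := exists_lt_ht_eq (not_le.1 hcon)
  have h1 : u.max = q := hu.le.1 u.isGreatest_max.1
  have h2 : (singleton q).max = q := max_eq isGreatest_singleton
  exact (max_lt_max hu).ne (h1.trans h2.symm)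

/-- An element below the maximum would cut off a proper initial segment with a maximum, i.e. a
predecessor. Hence the bottom level is countable. -/
theorem eq_singleton_of_isMin (h : IsMin (ht t)) : t = singleton t.max := by
  refine SigmaPrimeQ.ext (Set.ext fun x => ⟨fun hx => ?_, ?_⟩)
  · by_contra hne
    have hlt : x < t.max := lt_of_le_of_ne (t.isGreatest_max.2 hx) hne
    have hg : IsGreatest {y ∈ t.carrier | y ≤ x} x := ⟨⟨hx, le_rfl⟩, fun y hy => hy.2⟩
    let u : SigmaPrimeQ := ⟨{y ∈ t.carrier | y ≤ x}, t.isWF.mono fun y hy => hy.1, x, hg⟩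
    have hu : u ≤ t := ⟨fun y hy => hy.1, fun y hy hyu z hz =>
      hz.2.trans_lt (not_le.1 fun hyx => hyu ⟨hy, hyx⟩)⟩
    have hu' : u < t := (lt_iff_of_le hu le_rfl).2 (by rwa [max_eq (t := u) hg])
    exact h.not_lt (ht_lt_ht hu')
  · rintro rfl
    exact t.isGreatest_max.1

end SigmaPrimeQ

open SigmaPrimeQ

/-! ### Branches through ladders -/

/-- For almost all `ξ` in the ladder at `α`, the predecessors of `t` of height `ξ` satisfy `P`. -/
def AlmostAll (C : LadderSystem) (t : SigmaPrimeQ) (α : LimOmega1) (P : SigmaPrimeQ → Prop) :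
    Prop :=
  {ξ ∈ C.ladder α | ∃ u < t, ht u = ξ ∧ ¬ P u}.Finite

theorem LadderSystem.finite_ladder_inter_Iic (C : LadderSystem) (α : LimOmega1) {β : Omega1}
    (hβ : β < α.1) : {ξ ∈ C.ladder α | ξ ≤ β}.Finite := by
  obtain ⟨e⟩ := C.type_omega α
  obtain ⟨η, hη, hle⟩ := C.cofinal α β hβ
  refine ((Set.finite_Iic (e.symm ⟨η, hη⟩)).image fun n => (e n : Omega1)).subset ?_
  rintro ξ ⟨hξ, hξβ⟩
  refine ⟨e.symm ⟨ξ, hξ⟩, ?_, by simp⟩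
  exact e.symm.monotone (show (⟨ξ, hξ⟩ : C.ladder α) ≤ ⟨η, hη⟩ from hξβ.trans hle)

/-- The lower ladder is bounded in the larger limit, and only finitely many rungs of the other
ladder lie below that bound. -/
theorem LadderSystem.finite_inter (C : LadderSystem) {α β : LimOmega1} (h : α ≠ β) :
    (C.ladder α ∩ C.ladder β).Finite := by
  rcases lt_or_gt_of_ne h with h | h
  · exact (C.finite_ladder_inter_Iic β (β := α.1) h).subset fun ξ hξ =>
      ⟨hξ.2, (C.lt_of_mem α ξ hξ.1).le⟩
  · exact (C.finite_ladder_inter_Iic α (β := β.1) h).subset fun ξ hξ =>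
      ⟨hξ.1, (C.lt_of_mem β ξ hξ.2).le⟩

/-- If points of `S` can be extended in `S` to each level of the ladder at `α` by points which
satisfy `P`, then they can be extended to level `α` with predecessors in `S` which, on the ladder,
almost always satisfy `P`. -/
theorem exists_branch (C : LadderSystem) (α : LimOmega1) {S : Set SigmaPrimeQ}
    (hS : IsLowerSet S) {P : SigmaPrimeQ → Prop}
    (step : ∀ ξ ∈ C.ladder α, ∀ u ∈ S, ht u < ξ → ∀ q > u.max,
      ∃ t ∈ S, ht t = ξ ∧ u < t ∧ t.max < q ∧ P t)
    {s : SigmaPrimeQ} (hs : s ∈ S) (hsα : ht s < α.1) {r : ℚ} (hr : s.max < r) :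
    ∃ t, ht t = α.1 ∧ s < t ∧ t.max = r ∧ (∀ u < t, u ∈ S) ∧ AlmostAll C t α P := by
  obtain ⟨e⟩ := C.type_omega α
  obtain ⟨ξ₀, hξ₀, hle₀⟩ := C.cofinal α _ hsα
  -- The shift by one makes the first rung used strictly above `ht s`, although `ξ₀` may equal it.
  set k₀ := e.symm ⟨ξ₀, hξ₀⟩ + 1 with hk₀
  let ξ : ℕ → Omega1 := fun k => e (k₀ + k)
  have hξ : StrictMono ξ := fun a b hab => e.strictMono (Nat.add_lt_add_left hab k₀)
  have hξm : ∀ k, ξ k ∈ C.ladder α := fun k => (e (k₀ + k)).2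
  have hsξ : ht s < ξ 0 := by
    refine hle₀.trans_lt ?_
    have : (⟨ξ₀, hξ₀⟩ : C.ladder α) < e (k₀ + 0) := by
      rw [← e.symm_apply_lt]
      omega
    exact this
  have hcof : ∀ β < α.1, ∃ k, β ≤ ξ k := by
    intro β hβ
    obtain ⟨η, hη, hle⟩ := C.cofinal α β hβ
    refine ⟨e.symm ⟨η, hη⟩, hle.trans ?_⟩
    have : (⟨η, hη⟩ : C.ladder α) ≤ e (k₀ + e.symm ⟨η, hη⟩) := by
      rw [← e.symm_apply_le]
      omega
    exact this
  let G : ℕ → Type := fun k => {t : SigmaPrimeQ // t ∈ S ∧ ht t = ξ k ∧ s < t ∧ t.max < r ∧ P t}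
  obtain ⟨t₀, ht₀, h₀⟩ := step _ (hξm 0) s hs hsξ r hr
  have hnext : ∀ k (u : G k), ∃ v : G (k + 1), u.1 < v.1 := by
    rintro k ⟨u, huS, huh, hsu, hur, -⟩
    obtain ⟨v, hvS, hvh, huv, hvr, hv⟩ := step _ (hξm (k + 1)) u huS
      (huh ▸ hξ (Nat.lt_succ_self k)) r hur
    exact ⟨⟨v, hvS, hvh, hsu.trans huv, hvr, hv⟩, huv⟩
  choose next hnext using hnext
  let b : ∀ k, G k := fun k => Nat.rec ⟨t₀, ht₀, h₀⟩ next k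
  have hb : StrictMono fun k => (b k).1 := strictMono_nat_of_lt_succ fun k => hnext k (b k)
  obtain ⟨t, htm, hbt, hlt⟩ := exists_upper_bound hb.monotone fun k => (b k).2.2.2.2.1
  have hht : ht t = α.1 := by
    refine ht_eq_of (fun u hu => ?_) fun β hβ => ?_
    · obtain ⟨k, hk⟩ := hlt u hu
      exact ((ht_le_ht hk).trans_eq (b k).2.2.1).trans_lt (C.lt_of_mem α _ (hξm k))
    · obtain ⟨k, hk⟩ := hcof β hβ
      exact ⟨(b k).1, hbt k, hk.trans (b k).2.2.1.ge⟩
  refine ⟨t, hht, (b 0).2.2.2.1.trans (hbt 0), htm, fun u hu => ?_, ?_⟩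
  · obtain ⟨k, hk⟩ := hlt u hu
    exact hS hk (b k).2.1
  -- Every rung above `ξ₀` is the height of some `b k`, which satisfies `P`; exceptions lie at or
  -- below `ξ₀`.
  · refine (C.finite_ladder_inter_Iic α (C.lt_of_mem α _ hξ₀)).subset ?_
    rintro η ⟨hη, u, hu, rfl, hPu⟩
    refine ⟨hη, ?_⟩
    by_contra hcon
    have h1 : k₀ ≤ e.symm ⟨ht u, hη⟩ := by
      have : (⟨ξ₀, hξ₀⟩ : C.ladder α) < ⟨ht u, hη⟩ := not_le.1 hcon
      have := e.symm.strictMono this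
      omega
    obtain ⟨k, hk⟩ := Nat.exists_eq_add_of_le h1
    have h2 : ht (b k).1 = ht u := by
      rw [(b k).2.2.1]
      simp only [ξ, ← hk, OrderIso.apply_symm_apply]
    exact hPu (eq_of_ht_eq (hbt k).le hu.le h2 ▸ (b k).2.2.2.2.2)

/-! ### A tree closed under countably many requirements at each level -/

section Construction

variable (𝒬 : Omega1 → Set SigmaPrimeQ → Set (Set SigmaPrimeQ))

/-- The possible points of level `α` above `s`, with predecessors in `U` and maximum `r`, which
belong to `Q`. -/
def candidates (α : Omega1) (U Q : Set SigmaPrimeQ) (s : SigmaPrimeQ) (r : ℚ) :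
    Set SigmaPrimeQ :=
  {t | ht t = α ∧ s < t ∧ t.max = r ∧ (∀ u < t, u ∈ U) ∧ t ∈ Q}

/-- The next level above the union `U` of the earlier ones: one candidate for each requirement. -/
def nextLevel (α : Omega1) (U : Set SigmaPrimeQ) : Set SigmaPrimeQ :=
  {t | IsMin α ∧ ht t = α} ∪
    {t | ∃ Q ∈ 𝒬 α U, ∃ s ∈ U, ∃ r : ℚ, ∃ h : (candidates α U Q s r).Nonempty, h.some = t}

/-- The levels of the tree. -/
def levels : Omega1 → Set SigmaPrimeQ :=
  wellFounded_lt.fix fun α L => nextLevel 𝒬 α (⋃ β, ⋃ h : β < α, L β h)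

/-- The tree. -/
def reqTree : Set SigmaPrimeQ := {t | t ∈ levels 𝒬 (ht t)}

theorem levels_eq (α : Omega1) :
    levels 𝒬 α = nextLevel 𝒬 α (⋃ β, ⋃ _ : β < α, levels 𝒬 β) :=
  wellFounded_lt.fix_eq _ α

theorem ht_of_mem_levels {α : Omega1} {t : SigmaPrimeQ} (h : t ∈ levels 𝒬 α) : ht t = α := by
  rw [levels_eq] at h
  rcases h with h | ⟨Q, hQ, s, hs, r, hne, rfl⟩
  · exact h.2
  · exact hne.some_mem.1

theorem iUnion_levels (α : Omega1) :
    ⋃ β, ⋃ _ : β < α, levels 𝒬 β = {t ∈ reqTree 𝒬 | ht t < α} := by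
  ext t
  simp only [Set.mem_iUnion, reqTree, Set.mem_ofPred_eq, exists_prop]
  constructor
  · rintro ⟨β, hβ, h⟩
    obtain rfl := ht_of_mem_levels 𝒬 h
    exact ⟨h, hβ⟩
  · exact fun h => ⟨_, h.2, h.1⟩

theorem mem_reqTree_iff {t : SigmaPrimeQ} :
    t ∈ reqTree 𝒬 ↔ t ∈ nextLevel 𝒬 (ht t) {u ∈ reqTree 𝒬 | ht u < ht t} := by
  rw [← iUnion_levels, ← levels_eq]
  rfl

theorem isLowerSet_reqTree : IsLowerSet (reqTree 𝒬) := by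
  intro t u hut h
  rcases hut.eq_or_lt with rfl | hut
  · exact h
  rw [mem_reqTree_iff] at h
  rcases h with h | ⟨Q, hQ, s, hs, r, hne, heq⟩
  · exact absurd (ht_lt_ht hut) h.1.not_lt
  · exact (hne.some_mem.2.2.2.1 u (by rwa [heq])).1

theorem mem_reqTree_of_isMin {t : SigmaPrimeQ} (h : IsMin (ht t)) : t ∈ reqTree 𝒬 :=
  (mem_reqTree_iff 𝒬).2 (Or.inl ⟨h, rfl⟩)

/-- The witness `t` need not itself be chosen; it only makes the set of candidates nonempty.
Whatever is to survive the replacement of `t` by `t'` must be expressed by `Q`. -/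
theorem exists_mem_reqTree {α : Omega1} {Q : Set SigmaPrimeQ}
    (hQ : Q ∈ 𝒬 α {u ∈ reqTree 𝒬 | ht u < α}) {s t : SigmaPrimeQ} (hst : s < t)
    (ht' : ht t = α) (hpred : ∀ u < t, u ∈ reqTree 𝒬) (htQ : t ∈ Q) :
    ∃ t' ∈ reqTree 𝒬, ht t' = α ∧ s < t' ∧ t'.max = t.max ∧ t' ∈ Q := by
  have hne : (candidates α {u ∈ reqTree 𝒬 | ht u < α} Q s t.max).Nonempty :=
    ⟨t, ht', hst, rfl, fun u hu => ⟨hpred u hu, ht' ▸ ht_lt_ht hu⟩, htQ⟩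
  have hmem := hne.some_mem
  refine ⟨hne.some, ?_, hmem.1, hmem.2.1, hmem.2.2.1, hmem.2.2.2.2⟩
  rw [mem_reqTree_iff, hmem.1]
  exact Or.inr ⟨Q, hQ, s, ⟨hpred s hst, ht' ▸ ht_lt_ht hst⟩, _, hne, rfl⟩

variable {𝒬}

theorem countable_nextLevel {α : Omega1} {U : Set SigmaPrimeQ} (hU : U.Countable)
    (h𝒬 : (𝒬 α U).Countable) : (nextLevel 𝒬 α U).Countable := by
  refine Set.Countable.union ?_ ?_
  · refine (Set.countable_range singleton).mono ?_
    rintro t ⟨h, rfl⟩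
    exact ⟨_, (eq_singleton_of_isMin h).symm⟩
  · have := h𝒬.to_subtype
    have := hU.to_subtype
    refine (Set.countable_range
      fun x : {x : 𝒬 α U × U × ℚ // (candidates α U x.1.1 x.2.1 x.2.2).Nonempty} =>
        x.2.some).mono ?_
    rintro t ⟨Q, hQ, s, hs, r, hne, rfl⟩
    exact ⟨⟨⟨⟨Q, hQ⟩, ⟨s, hs⟩, r⟩, hne⟩, rfl⟩

theorem countable_levels (h𝒬 : ∀ α U, U.Countable → (𝒬 α U).Countable) (α : Omega1) :
    (levels 𝒬 α).Countable := by
  induction α using WellFoundedLT.induction with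
  | ind α ih =>
    rw [levels_eq]
    have hU : (⋃ β, ⋃ _ : β < α, levels 𝒬 β).Countable :=
      Set.Countable.biUnion (Omega1.countable_Iio α) ih
    exact countable_nextLevel hU (h𝒬 _ _ hU)

theorem countable_reqTree_Iic (h𝒬 : ∀ α U, U.Countable → (𝒬 α U).Countable) (α : Omega1) :
    {t ∈ reqTree 𝒬 | ht t ≤ α}.Countable := by
  refine (Set.Countable.biUnion (Omega1.countable_Iic α)
    fun β _ => countable_levels h𝒬 β).mono fun t h => ?_
  exact Set.mem_biUnion h.2 h.1

/-- Every point of the tree has extensions of each height with each possible maximum. -/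
theorem exists_extension (C : LadderSystem) (huniv : ∀ α U, Set.univ ∈ 𝒬 α U) (α : Omega1) :
    ∀ s ∈ reqTree 𝒬, ht s < α → ∀ r > s.max,
      ∃ t ∈ reqTree 𝒬, ht t = α ∧ s < t ∧ t.max = r := by
  induction α using WellFoundedLT.induction with
  | ind α ih =>
    intro s hs hsα r hr
    suffices h : ∃ t, ht t = α ∧ s < t ∧ t.max = r ∧ ∀ u < t, u ∈ reqTree 𝒬 by
      obtain ⟨t, h1, h2, rfl, h3⟩ := h
      obtain ⟨t', h⟩ := exists_mem_reqTree 𝒬 (huniv α _) h2 h1 h3 trivial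
      exact ⟨t', h.1, h.2.1, h.2.2.1, h.2.2.2.1⟩
    rcases Omega1.exists_covBy_or_isSuccLimit (fun h => h.not_lt hsα) with ⟨β, hβ⟩ | hα
    · obtain ⟨s', hs', hs'β, hss', hs'r⟩ : ∃ s' ∈ reqTree 𝒬, ht s' = β ∧ s ≤ s' ∧ s'.max < r := by
        rcases (hβ.le_of_lt hsα).eq_or_lt with h | h
        · exact ⟨s, hs, h, le_rfl, hr⟩
        · obtain ⟨q, hq, hqr⟩ := exists_between hr
          obtain ⟨t, h1, h2, h3, rfl⟩ := ih β hβ.lt s hs h q hq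
          exact ⟨t, h1, h2, h3.le, hqr⟩
      obtain ⟨t, h1, h2, h3⟩ := exists_upper_bound (s := fun _ => s') monotone_const
        (r := r) fun _ => hs'r
      refine ⟨t, ht_eq_of (fun u hu => ?_) fun ξ hξ => ⟨s', h2 0, ?_⟩, hss'.trans_lt (h2 0), h1,
        fun u hu => ?_⟩
      · obtain ⟨-, hk⟩ := h3 u hu
        exact ((ht_le_ht hk).trans_eq hs'β).trans_lt hβ.lt
      · exact (hβ.le_of_lt hξ).trans_eq hs'β.symm
      · obtain ⟨-, hk⟩ := h3 u hu
        exact isLowerSet_reqTree 𝒬 hk hs'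
    -- At a limit only the bound on the maxima matters, so the property along the ladder is trivial.
    · obtain ⟨t, h1, h2, h3, h4, -⟩ := exists_branch C ⟨α, hα⟩ (isLowerSet_reqTree 𝒬)
        (P := fun _ => True) (fun ξ hξ u hu huξ q hq => by
          obtain ⟨q', hq', hqq'⟩ := exists_between hq
          obtain ⟨t, h1, h2, h3, rfl⟩ := ih ξ (C.lt_of_mem _ ξ hξ) u hu huξ q' hq'
          exact ⟨t, h1, h2, h3, hqq', trivial⟩) hs hsα hr
      exact ⟨t, h1, h2, h3, h4⟩

end Construction

/-! ### Subtrees of the tree of well-ordered sets of rationals -/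

/-- Fibres of `max` are antichains, as `max` is strictly increasing. -/
theorem isSpecial_of_set (T : Set SigmaPrimeQ) : IsSpecial T := by
  obtain ⟨e, he⟩ := exists_surjective_nat ℚ
  refine ⟨fun n => {t | t.1.max = e n}, fun n s hs t ht hne hle => ?_, ?_⟩
  · exact (max_lt_max (lt_of_le_of_ne (show s.1 ≤ t.1 from hle) fun h => hne (Subtype.ext h))).ne
      (hs.trans (Eq.symm ht))
  · refine Set.eq_univ_of_forall fun t => ?_
    obtain ⟨n, hn⟩ := he t.1.max
    exact Set.mem_iUnion.2 ⟨n, hn.symm⟩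

theorem IsSpecial.countable_of_isChain {P : Type} [PartialOrder P] (h : IsSpecial P) {c : Set P}
    (hc : IsChain (· ≤ ·) c) : c.Countable := by
  obtain ⟨A, hA, hu⟩ := h
  rw [← Set.inter_univ c, ← hu, Set.inter_iUnion]
  refine Set.countable_iUnion fun n => Set.Subsingleton.countable fun s hs t ht => ?_
  by_contra hne
  rcases hc hs.1 ht.1 hne with hle | hle
  · exact hA n hs.2 ht.2 hne hle
  · exact hA n ht.2 hs.2 (Ne.symm hne) hle

section

variable {𝒬 : Omega1 → Set SigmaPrimeQ → Set (Set SigmaPrimeQ)}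

theorem exists_ge_ht (C : LadderSystem) (huniv : ∀ α U, Set.univ ∈ 𝒬 α U) {s : SigmaPrimeQ}
    (hs : s ∈ reqTree 𝒬) (α : Omega1) : ∃ t ∈ reqTree 𝒬, s ≤ t ∧ α ≤ ht t := by
  rcases le_or_gt α (ht s) with h | h
  · exact ⟨s, hs, le_rfl, h⟩
  · obtain ⟨t, h1, h2, h3, -⟩ := exists_extension C huniv α s hs h (s.max + 1) (lt_add_one _)
    exact ⟨t, h1, h3.le, h2.ge⟩

theorem isSubtree_reqTree (C : LadderSystem) (huniv : ∀ α U, Set.univ ∈ 𝒬 α U) :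
    IsSubtree (reqTree 𝒬) where
  nonempty := ⟨_, mem_reqTree_of_isMin 𝒬 (ht_singleton 0)⟩
  isLowerSet := isLowerSet_reqTree 𝒬
  pruned _ hs β hβ := exists_ge_ht C huniv hs ⟨β, hβ⟩

theorem isAronszajn_reqTree (C : LadderSystem) (huniv : ∀ α U, Set.univ ∈ 𝒬 α U)
    (h𝒬 : ∀ α U, U.Countable → (𝒬 α U).Countable) : IsAronszajn (reqTree 𝒬) where
  level_nonempty_iff α := by
    constructor
    · rintro ⟨t, h⟩
      rw [← show height t = α from h, ← height_coe (isLowerSet_reqTree 𝒬)]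
      exact (ht t.1).2
    · intro h
      obtain ⟨t, h1, -, h2⟩ := exists_ge_ht C huniv
        (mem_reqTree_of_isMin 𝒬 (ht_singleton 0)) ⟨α, h⟩
      obtain ⟨u, hut, hu⟩ := exists_le_ht_eq h2
      refine ⟨⟨u, isLowerSet_reqTree 𝒬 hut h1⟩, ?_⟩
      exact (height_coe (isLowerSet_reqTree 𝒬) _).symm.trans (congrArg Subtype.val hu)
  level_countable α := by
    by_cases h : α < Ordinal.omega 1
    · refine ((countable_levels h𝒬 ⟨α, h⟩).preimage Subtype.val_injective).mono fun t h' => ?_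
      have : ht t.1 = ⟨α, h⟩ :=
        Subtype.ext ((height_coe (isLowerSet_reqTree 𝒬) t).trans h')
      exact this ▸ t.2
    · refine Set.countable_empty.mono fun t h' => h ?_
      rw [← show height t = α from h', ← height_coe (isLowerSet_reqTree 𝒬)]
      exact (ht t.1).2
  chain_countable _ hc := (isSpecial_of_set _).countable_of_isChain hc

end

/-! ### A colouring lemma -/

/-- List all pairs `(k, n)`. At step `m` a fresh point of the relevant `B k` is given colour `n`,
avoiding the first `m` of the sets `A i`; thus each `A i` receives only finitely many coloured
points. -/
theorem exists_partial_coloring {X ι κ : Type*} [Countable ι] [Countable κ] (A : ι → Set X)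
    (B : κ → Set X) (hB : ∀ k, (B k).Infinite) (hAB : ∀ i k, (A i ∩ B k).Finite) :
    ∃ p : X → Option ℕ, (∀ i, {x ∈ A i | p x ≠ none}.Finite) ∧
      ∀ k n, ∃ x ∈ B k, p x = some n := by
  classical
  rcases isEmpty_or_nonempty κ with hκ | hκ
  · exact ⟨fun _ => none, fun i => by simp, fun k => hκ.elim k⟩
  obtain ⟨e, he⟩ := Countable.exists_injective_nat ι
  obtain ⟨g, hg⟩ := exists_surjective_nat (κ × ℕ)
  have hex : ∀ (F : Finset X) (m : ℕ), ∃ x ∈ B (g m).1, x ∉ F ∧ ∀ i, e i < m → x ∉ A i := by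
    intro F m
    have hf : ((F : Set X) ∪ ⋃ i ∈ {i | e i < m}, A i ∩ B (g m).1).Finite :=
      F.finite_toSet.union
        (((Set.finite_Iio m).preimage he.injOn).biUnion fun i _ => hAB i (g m).1)
    obtain ⟨x, hx, hx'⟩ := (hB (g m).1).exists_notMem_finite hf
    refine ⟨x, hx, fun h => hx' (Or.inl h), fun i hi hxi => hx' (Or.inr ?_)⟩
    exact Set.mem_biUnion (show i ∈ {i | e i < m} from hi) ⟨hxi, hx⟩
  choose v hvB hvF hvA using hex
  let G : ℕ → Finset X := fun n => Nat.rec ∅ (fun m F => insert (v F m) F) n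
  let y : ℕ → X := fun n => v (G n) n
  have hG : Monotone G := monotone_nat_of_le_succ fun n => Finset.subset_insert _ _
  have hyG : ∀ {m n}, m < n → y m ∈ G n := fun {m n} h =>
    hG (Nat.succ_le_of_lt h) (Finset.mem_insert_self _ _)
  have hy : Function.Injective y := by
    intro m n h
    rcases lt_trichotomy m n with h' | h' | h'
    · exact absurd (h ▸ hyG h') (hvF _ _)
    · exact h'
    · exact absurd (h ▸ hyG h') (hvF _ _)
  refine ⟨fun x => if h : ∃ n, y n = x then some (g h.choose).2 else none, fun i => ?_,
    fun k n => ?_⟩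
  · refine ((Set.finite_Iic (e i)).image y).subset ?_
    rintro x ⟨hx, hne⟩
    obtain ⟨n, rfl⟩ : ∃ n, y n = x := by
      by_contra h
      exact hne (dif_neg h)
    refine ⟨n, ?_, rfl⟩
    by_contra hcon
    exact hvA _ n i (not_le.1 hcon) hx
  · obtain ⟨m, hm⟩ := hg (k, n)
    refine ⟨y m, ?_, ?_⟩
    · have := hvB (G m) m
      rwa [hm] at this
    · have h : ∃ l, y l = y m := ⟨m, rfl⟩
      simp only [dif_pos h, hy h.choose_spec, hm]

/-- Countably many sets can be coloured almost constantly with prescribed colours, provided that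
those with different colours are almost disjoint, in such a way that each of countably many
infinite sets which are almost disjoint from these receives all colours. -/
theorem exists_coloring {X ι κ : Type*} [Countable ι] [Countable κ] (A : ι → Set X) (c : ι → ℕ)
    (B : κ → Set X) (hA : ∀ i j, c i = c j ∨ (A i ∩ A j).Finite) (hB : ∀ k, (B k).Infinite)
    (hAB : ∀ i k, (A i ∩ B k).Finite) :
    ∃ ψ : X → ℕ, (∀ i, {x ∈ A i | ψ x ≠ c i}.Finite) ∧ ∀ k n, ∃ x ∈ B k, ψ x = n := by
  classical
  obtain ⟨p, hpA, hpB⟩ := exists_partial_coloring A B hB hAB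
  obtain ⟨e, he⟩ := Countable.exists_injective_nat ι
  have hmin : ∀ x, (∃ i, x ∈ A i) → ∃ i, x ∈ A i ∧ ∀ j, x ∈ A j → e i ≤ e j := fun x ⟨i, hi⟩ =>
    (measure e).wf.has_min {i | x ∈ A i} ⟨i, hi⟩ |>.imp fun j hj =>
      ⟨hj.1, fun l hl => not_lt.1 (hj.2 l hl)⟩
  -- A point left uncoloured by `p` follows the first `A j` containing it. An error on `A i` then
  -- comes from one of finitely many earlier sets with another colour, each meeting `A i` finitely.
  refine ⟨fun x => (p x).getD (if h : ∃ i, x ∈ A i then c (hmin x h).choose else 0), fun i => ?_,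
    fun k n => ?_⟩
  · have hf : (⋃ j ∈ {j | e j ≤ e i ∧ (A i ∩ A j).Finite}, A i ∩ A j).Finite :=
      Set.Finite.biUnion (((Set.finite_Iic (e i)).preimage he.injOn).subset fun j hj => hj.1)
        fun j hj => hj.2
    refine ((hpA i).union hf).subset ?_
    rintro x ⟨hx, hne⟩
    by_cases hpx : p x = none
    · have h : ∃ i, x ∈ A i := ⟨i, hx⟩
      simp only [hpx, Option.getD_none, dif_pos h] at hne
      obtain ⟨h1, h2⟩ := (hmin x h).choose_spec
      refine Or.inr (Set.mem_biUnion (x := (hmin x h).choose) ⟨h2 i hx, ?_⟩ ⟨hx, h1⟩)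
      exact (hA i _).resolve_left fun h => hne h.symm
    · exact Or.inl ⟨hx, hpx⟩
  · obtain ⟨x, hx, hpx⟩ := hpB k n
    exact ⟨x, hx, by simp [hpx]⟩

/-- A colouring of the rationals which takes every value in every interval. -/
theorem exists_dense_coloring : ∃ c : ℚ → ℕ, ∀ (a b : ℚ) (n : ℕ), a < b →
    ∃ q, a < q ∧ q < b ∧ c q = n := by
  obtain ⟨c, -, hc⟩ := exists_coloring (X := ℚ) (ι := Empty) (κ := {x : ℚ × ℚ // x.1 < x.2})
    (fun i => i.elim) (fun i => i.elim) (fun k => Set.Ioo k.1.1 k.1.2) (fun i => i.elim)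
    (fun k => Set.Ioo_infinite k.2) (fun i => i.elim)
  refine ⟨c, fun a b n h => ?_⟩
  obtain ⟨q, hq, hn⟩ := hc ⟨(a, b), h⟩ n
  exact ⟨q, hq.1, hq.2, hn⟩

/-! ### Good colourings, the canonical colouring and its uniform part. -/

section Uniformization

variable (C : LadderSystem)

theorem almostAll_congr {s t : SigmaPrimeQ} (h : s ≤ t) {β : LimOmega1} (hβ : β.1 ≤ ht s)
    (P : SigmaPrimeQ → Prop) : AlmostAll C s β P ↔ AlmostAll C t β P := by
  refine Eq.to_iff (congrArg Set.Finite (Set.ext fun ξ => and_congr_right fun hξ => ?_))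
  refine exists_congr fun u => ⟨fun hu => ⟨hu.1.trans_le h, hu.2⟩, fun hu => ⟨?_, hu.2⟩⟩
  exact lt_of_ht_lt hu.1.le h (hu.2.1 ▸ (C.lt_of_mem β ξ hξ).trans_le hβ)

theorem AlmostAll.mono {C : LadderSystem} {t : SigmaPrimeQ} {α : LimOmega1}
    {P Q : SigmaPrimeQ → Prop} (h : AlmostAll C t α P) (hPQ : ∀ u < t, ht u < α.1 → P u → Q u) :
    AlmostAll C t α Q := by
  refine Set.Finite.subset h ?_
  rintro ξ ⟨hξ, u, hu, rfl, hQ⟩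
  exact ⟨hξ, u, hu, rfl, fun hP => hQ (hPQ u hu (C.lt_of_mem α _ hξ) hP)⟩

/-! ### Uniformizations of bounded parts of the tree -/

/-- On the part of `U` of height at most `ε`, the map `ψ` uniformizes the colouring by constants
`g`, and it takes all values on each level above each point. -/
structure IsGood (ε : Omega1) (U : Set SigmaPrimeQ) (g : LimOmega1 → ℕ) (ψ : SigmaPrimeQ → ℕ) :
    Prop where
  almostAll : ∀ β : LimOmega1, ∀ t ∈ U, ht t = β.1 → β.1 ≤ ε → AlmostAll C t β (ψ · = g β)
  surj : ∀ s ∈ U, ∀ ξ < ε, ht s < ξ → ∀ q > s.max, ∀ n,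
    ∃ t ∈ U, ht t = ξ ∧ s < t ∧ t.max < q ∧ ψ t = n

theorem IsGood.congr {C : LadderSystem} {ε : Omega1} {U U' : Set SigmaPrimeQ}
    {g g' : LimOmega1 → ℕ} {ψ : SigmaPrimeQ → ℕ} (hU : ∀ u, ht u ≤ ε → (u ∈ U ↔ u ∈ U'))
    (hg : ∀ β : LimOmega1, β.1 ≤ ε → g β = g' β) (h : IsGood C ε U g ψ) :
    IsGood C ε U' g' ψ where
  almostAll β t ht' hβ hε := by
    rw [← hg β hε]
    exact h.almostAll β t ((hU t (hβ.trans_le hε)).2 ht') hβ hε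
  surj s hs ξ hξ hsξ q hq n := by
    obtain ⟨t, h1, h2, h3⟩ := h.surj s ((hU s (hsξ.trans hξ).le).2 hs) ξ hξ hsξ q hq n
    exact ⟨t, (hU t (h2.trans_le hξ.le)).1 h1, h2, h3⟩

/-- Apply `exists_coloring` to the ladder traces `A` below points of limit height and to the sets
`B` of extensions on which all colours must occur. Only countably many points and levels are
involved. -/
theorem exists_isGood {T : Set SigmaPrimeQ}
    (hcount : ∀ ε, {t ∈ T | ht t ≤ ε}.Countable)
    (hext : ∀ α, ∀ s ∈ T, ht s < α → ∀ r > s.max, ∃ t ∈ T, ht t = α ∧ s < t ∧ t.max = r)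
    (ε : Omega1) (g : LimOmega1 → ℕ) : ∃ ψ, IsGood C ε T g ψ := by
  have := (hcount ε).to_subtype
  have := (Omega1.countable_Iio ε).to_subtype
  let ι := {t : {t ∈ T | ht t ≤ ε} // Order.IsSuccLimit (ht t.1)}
  let lim : ι → LimOmega1 := fun t => ⟨ht t.1.1, t.2⟩
  let κ := {x : {t ∈ T | ht t ≤ ε} × Set.Iio ε × ℚ // ht x.1.1 < x.2.1.1 ∧ x.1.1.max < x.2.2}
  let A : ι → Set SigmaPrimeQ := fun t => {u | u < t.1.1 ∧ ht u ∈ C.ladder (lim t)}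
  let B : κ → Set SigmaPrimeQ := fun x =>
    {t | t ∈ T ∧ ht t = x.1.2.1.1 ∧ x.1.1.1 < t ∧ t.max < x.1.2.2}
  have hinj : ∀ t : ι, Set.InjOn ht (A t) := fun t u hu v hv h => eq_of_ht_eq hu.1.le hv.1.le h
  -- Traces at the same height have the same colour; at different heights the ladders are almost
  -- disjoint.
  have hA : ∀ i j, g (lim i) = g (lim j) ∨ (A i ∩ A j).Finite := by
    intro i j
    by_cases h : lim i = lim j
    · exact Or.inl (congrArg g h)
    · refine Or.inr (Set.Finite.of_finite_image ((C.finite_inter h).subset ?_)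
        ((hinj i).mono Set.inter_subset_left))
      rintro _ ⟨u, hu, rfl⟩
      exact ⟨hu.1.2, hu.2.2⟩
  have hB : ∀ k, (B k).Infinite := by
    rintro ⟨⟨s, ξ, q⟩, hsξ, hq⟩
    refine Set.Infinite.of_image max ((Set.Ioo_infinite hq).mono fun r hr => ?_)
    obtain ⟨t, h1, h2, h3, rfl⟩ := hext ξ s s.2.1 hsξ r hr.1
    exact ⟨t, ⟨h1, h2, h3, hr.2⟩, rfl⟩
  -- A trace is a chain and each `B k` lies in a single level.
  have hAB : ∀ i k, (A i ∩ B k).Finite := by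
    intro i k
    refine Set.Subsingleton.finite fun u hu v hv => hinj i hu.1 hv.1 ?_
    exact hu.2.2.1.trans hv.2.2.1.symm
  obtain ⟨ψ, h1, h2⟩ := exists_coloring A (fun t => g (lim t)) B hA hB hAB
  refine ⟨ψ, fun β t htT htβ hβ => ?_, fun s hs ξ hξ hsξ q hq n => ?_⟩
  · let i : ι := ⟨⟨t, htT, htβ.trans_le hβ⟩, by rw [htβ]; exact β.2⟩
    have hi : lim i = β := Subtype.ext htβ
    refine ((h1 i).image ht).subset ?_
    rintro ξ ⟨hξ, u, hu, rfl, hne⟩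
    exact ⟨u, ⟨⟨hu, hi ▸ hξ⟩, by rw [hi]; exact hne⟩, rfl⟩
  · obtain ⟨t, ht', hn⟩ := h2 ⟨(⟨s, hs, (hsξ.trans hξ).le⟩, ⟨ξ, hξ⟩, q), hsξ, hq⟩ n
    exact ⟨t, ht'.1, ht'.2.1, ht'.2.2.1, ht'.2.2.2, hn⟩

/-- A good colouring up to `ε`, which depends only on the part of the data up to `ε`. -/
noncomputable def piece (ε : Omega1) (U : Set SigmaPrimeQ) (g : LimOmega1 → ℕ) :
    SigmaPrimeQ → ℕ :=
  Classical.epsilon (IsGood C ε U g)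

theorem piece_congr {ε : Omega1} {U U' : Set SigmaPrimeQ} {g g' : LimOmega1 → ℕ}
    (hU : ∀ u, ht u ≤ ε → (u ∈ U ↔ u ∈ U')) (hg : ∀ β : LimOmega1, β.1 ≤ ε → g β = g' β) :
    piece C ε U g = piece C ε U' g' :=
  congrArg Classical.epsilon (funext fun _ => propext
    ⟨fun h => h.congr hU hg, fun h => h.congr (fun u hu => (hU u hu).symm)
      fun β hβ => (hg β hβ).symm⟩)

/-! ### The canonical colouring along a club -/

/-- `ε` is the least element of `D` above `α`. -/
def IsNext (D : Set Omega1) (α ε : Omega1) : Prop :=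
  ε ∈ D ∧ α < ε ∧ ∀ η ∈ D, α < η → ε ≤ η

/-- The least element of `D` above `α`. -/
noncomputable def next (D : Set Omega1) (α : Omega1) : Omega1 :=
  @Classical.epsilon _ ⟨α⟩ (IsNext D α)

theorem IsNext.next_eq {D : Set Omega1} {α ε : Omega1} (h : IsNext D α ε) : next D α = ε := by
  have h' : IsNext D α (next D α) := @Classical.epsilon_spec_aux _ ⟨α⟩ _ ⟨ε, h⟩
  exact le_antisymm (h'.2.2 ε h.1 h.2.1) (h.2.2 _ h'.1 h'.2.1)

theorem exists_isNext {D : Set Omega1} {α η : Omega1} (hη : η ∈ D) (h : α < η) :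
    ∃ ε, IsNext D α ε := by
  obtain ⟨ε, hε, hmin⟩ := wellFounded_lt.has_min {η ∈ D | α < η} ⟨η, hη, h⟩
  exact ⟨ε, hε.1, hε.2, fun ζ hζ hαζ => not_lt.1 (hmin ζ ⟨hζ, hαζ⟩)⟩

/-- A colouring of the rationals which takes every value in every interval. -/
noncomputable def denseColor : ℚ → ℕ := exists_dense_coloring.choose

open Classical in
/-- The colouring of the tree `U` associated to a club `D` and a colouring `g` of the ladders. -/
noncomputable def treeColor (D : Set Omega1) (g : LimOmega1 → ℕ) (U : Set SigmaPrimeQ)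
    (u : SigmaPrimeQ) : ℕ :=
  if ht u ∈ D then denseColor u.max else piece C (next D (ht u)) U g u

theorem treeColor_of_mem {D : Set Omega1} {g : LimOmega1 → ℕ} {U : Set SigmaPrimeQ}
    {u : SigmaPrimeQ} (h : ht u ∈ D) : treeColor C D g U u = denseColor u.max :=
  if_pos h

theorem treeColor_of_notMem {D : Set Omega1} {g : LimOmega1 → ℕ} {U : Set SigmaPrimeQ}
    {u : SigmaPrimeQ} {ε : Omega1} (h : ht u ∉ D) (hε : IsNext D (ht u) ε) :
    treeColor C D g U u = piece C ε U g u :=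
  (if_neg h).trans (by rw [hε.next_eq])

/-- `α` is an accumulation point of `D`. -/
def IsAcc (D : Set Omega1) (α : Omega1) : Prop :=
  ∀ β < α, ∃ η ∈ D, β < η ∧ η < α

/-- Closedness of `D`; zero is excluded because it is vacuously an accumulation point. -/
theorem IsAcc.mem {D : Set Omega1} (hD : IsClub D) {α : Omega1} (h : IsAcc D α)
    (hα : ¬ IsMin α) : α ∈ D := by
  rw [not_isMin_iff] at hα
  obtain ⟨β, hβ⟩ := hα
  obtain ⟨η, hη, -, hηα⟩ := h β hβ
  refine hD.isLUB_mem (t := D ∩ Set.Iio α) Set.inter_subset_left ⟨η, hη, hηα⟩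
    ⟨fun ζ hζ => le_of_lt hζ.2, fun b hb => ?_⟩
  by_contra hcon
  obtain ⟨ζ, hζ, hbζ, hζα⟩ := h b (not_le.1 hcon)
  exact hbζ.not_ge (hb ⟨hζ, hζα⟩)

theorem IsAcc.isSuccLimit {D : Set Omega1} {α : Omega1} (h : IsAcc D α) (hα : ¬ IsMin α) :
    Order.IsSuccLimit α :=
  ⟨hα, fun β hβ => by
    obtain ⟨η, -, h1, h2⟩ := h β hβ.lt
    exact hβ.2 h1 h2⟩

/-- Since `D` accumulates at `α`, the next element of `D` above `ht u` is still below `α`, and the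
piece used at `u` sees nothing beyond it. -/
theorem treeColor_congr {D : Set Omega1} {g g' : LimOmega1 → ℕ} {U : Set SigmaPrimeQ}
    {α : Omega1} (hα : IsAcc D α) (hg : ∀ β : LimOmega1, β.1 < α → g' β = g β)
    {u : SigmaPrimeQ} (hu : ht u < α) :
    treeColor C (D ∩ Set.Iio α) g' {v ∈ U | ht v < α} u = treeColor C D g U u := by
  have hiff : ht u ∈ D ∩ Set.Iio α ↔ ht u ∈ D := ⟨fun h => h.1, fun h => ⟨h, hu⟩⟩
  obtain ⟨η, hη, huη, hηα⟩ := hα _ hu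
  obtain ⟨ε, hε⟩ := exists_isNext hη huη
  have hεα : ε < α := (hε.2.2 η hη huη).trans_lt hηα
  have hε' : IsNext (D ∩ Set.Iio α) (ht u) ε :=
    ⟨⟨hε.1, hεα⟩, hε.2.1, fun ζ hζ h => hε.2.2 ζ hζ.1 h⟩
  have hp : piece C ε {v ∈ U | ht v < α} g' = piece C ε U g :=
    piece_congr C (fun v hv => ⟨fun h => h.1, fun h => ⟨h, hv.trans_lt hεα⟩⟩)
      fun β hβ => hg β (hβ.trans_lt hεα)
  unfold treeColor
  rw [hε.next_eq, hε'.next_eq, hp]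
  by_cases h : ht u ∈ D
  · rw [if_pos h, if_pos (hiff.2 h)]
  · rw [if_neg h, if_neg (hiff.not.2 h)]

/-- The part of the tree on which the canonical colouring uniformizes `g`. -/
def uniformPart (D : Set Omega1) (g : LimOmega1 → ℕ) (U : Set SigmaPrimeQ) : Set SigmaPrimeQ :=
  {t ∈ U | ∀ β : LimOmega1, β.1 ≤ ht t → AlmostAll C t β (treeColor C D g U · = g β)}

variable {C} {T : Set SigmaPrimeQ} {D : Set Omega1} {g : LimOmega1 → ℕ}

theorem isLowerSet_uniformPart (hT : IsLowerSet T) : IsLowerSet (uniformPart C D g T) :=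
  fun _ _ hut h => ⟨hT hut h.1, fun β hβ =>
    (almostAll_congr C hut hβ _).2 (h.2 β (hβ.trans (ht_le_ht hut)))⟩

/-- For limits `β` above `ht s`, almost all rungs lie inside the gap, where the colouring is one
single good piece. Its domain reaches `ε`, the least element of `D` with `β ≤ ε`; the case `β = ε`
is why good colourings must uniformize at `ε` too. -/
theorem mem_uniformPart_of_gap (hT : IsLowerSet T) (hD : IsClub D)
    (hgood : ∀ ε, IsGood C ε T g (piece C ε T g)) {s t : SigmaPrimeQ}
    (hs : s ∈ uniformPart C D g T) (ht' : t ∈ T) (hst : s ≤ t)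
    (hgap : ∀ η ∈ D, ht s < η → ht t ≤ η) : t ∈ uniformPart C D g T := by
  refine ⟨ht', fun β hβ => ?_⟩
  rcases le_or_gt β.1 (ht s) with hβs | hβs
  · exact (almostAll_congr C hst hβs _).1 (hs.2 β hβs)
  obtain ⟨η₀, hη₀, hη₀β⟩ := hD.isCofinal β.1
  obtain ⟨ε, hε, hmin⟩ := wellFounded_lt.has_min {η ∈ D | β.1 ≤ η} ⟨η₀, hη₀, hη₀β⟩
  obtain ⟨t', htt, hβt⟩ := exists_le_ht_eq hβ
  have h := (almostAll_congr C htt hβt.ge _).1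
    ((hgood ε).almostAll β t' (hT htt ht') hβt hε.2)
  refine (h.union (C.finite_ladder_inter_Iic β hβs)).subset ?_
  rintro ξ ⟨hξ, u, hut, rfl, hne⟩
  rcases le_or_gt (ht u) (ht s) with hus | hus
  · exact Or.inr ⟨hξ, hus⟩
  refine Or.inl ⟨hξ, u, hut, rfl, ?_⟩
  have huβ := C.lt_of_mem β _ hξ
  have huD : ht u ∉ D := fun h => (hgap _ h hus).not_gt (ht_lt_ht hut)
  have hnext : IsNext D (ht u) ε := by
    refine ⟨hε.1, huβ.trans_le hε.2, fun η hη huη => not_lt.1 fun hlt => ?_⟩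
    exact hmin η ⟨hη, hβ.trans (hgap η hη (hus.trans huη))⟩ hlt
  exact fun hc => hne ((treeColor_of_notMem C huD hnext).trans hc)

/-- The requirement at level `α` which is given by guesses `g` and `D` below `α` and by a colour
for `α`. -/
def requirement (C : LadderSystem) (α : Omega1) (U : Set SigmaPrimeQ) (D : Set Omega1)
    (g : LimOmega1 → ℕ) (n : ℕ) : Set SigmaPrimeQ :=
  {t | ∀ β : LimOmega1, (β.1 < α → AlmostAll C t β (treeColor C D g U · = g β)) ∧
    (β.1 = α → AlmostAll C t β (treeColor C D g U · = n))}

/-- Induction on `α`; prescribing the maximum exactly leaves room to pass limits and gives access to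
every dense colour. -/
theorem exists_mem_uniformPart (hT : IsLowerSet T) (hD : IsClub D)
    (hgood : ∀ ε, IsGood C ε T g (piece C ε T g))
    (hext : ∀ α, ∀ s ∈ T, ht s < α → ∀ r > s.max, ∃ t ∈ T, ht t = α ∧ s < t ∧ t.max = r)
    (hreq : ∀ α : LimOmega1, IsAcc D α.1 → ∀ s t, s < t → ht t = α.1 → (∀ u < t, u ∈ T) →
      (∀ β : LimOmega1, β.1 ≤ α.1 → AlmostAll C t β (treeColor C D g T · = g β)) →
      ∃ t' ∈ T, ht t' = α.1 ∧ s < t' ∧ t'.max = t.max ∧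
        ∀ β : LimOmega1, β.1 ≤ α.1 → AlmostAll C t' β (treeColor C D g T · = g β))
    (α : Omega1) : ∀ s ∈ uniformPart C D g T, ht s < α → ∀ r > s.max,
      ∃ t ∈ uniformPart C D g T, ht t = α ∧ s < t ∧ t.max = r := by
  induction α using WellFoundedLT.induction with
  | ind α ih =>
    have hpre : ∀ α' ≤ α, ∀ γ < α', ∀ s ∈ uniformPart C D g T, ht s < α' → ∀ r > s.max,
        ∃ s' ∈ uniformPart C D g T, s ≤ s' ∧ γ ≤ ht s' ∧ ht s' < α' ∧ s'.max < r := by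
      intro α' hα' γ hγ s hs hsα r hr
      rcases le_or_gt γ (ht s) with h | h
      · exact ⟨s, hs, le_rfl, h, hsα, hr⟩
      · obtain ⟨q, hq, hqr⟩ := exists_between hr
        obtain ⟨t, h1, h2, h3, rfl⟩ := ih γ (hγ.trans_le hα') s hs h q hq
        exact ⟨t, h1, h3.le, h2.ge, h2.trans_lt hγ, hqr⟩
    -- Every colour is available below `α`: on levels in `D` by choosing the maximum, on other
    -- levels by first climbing into the gap and then using surjectivity of the piece.
    have hcol : ∀ ξ < α, ∀ s ∈ uniformPart C D g T, ht s < ξ → ∀ q > s.max, ∀ n,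
        ∃ t ∈ uniformPart C D g T, ht t = ξ ∧ s < t ∧ t.max < q ∧ treeColor C D g T t = n := by
      intro ξ hξ s hs hsξ q hq n
      by_cases hξD : ξ ∈ D
      · obtain ⟨r, hr, hrq, hn⟩ := exists_dense_coloring.choose_spec s.max q n hq
        obtain ⟨t, h1, h2, h3, rfl⟩ := ih ξ hξ s hs hsξ r hr
        exact ⟨t, h1, h2, h3, hrq, (treeColor_of_mem C (h2 ▸ hξD)).trans hn⟩
      · have hacc : ¬ IsAcc D ξ := fun h => hξD (h.mem hD fun h => h.not_lt hsξ)
        rw [IsAcc] at hacc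
        push Not at hacc
        obtain ⟨γ, hγ, hgap⟩ := hacc
        obtain ⟨s', hs', hss', hγs', hs'ξ, hs'q⟩ := hpre ξ hξ.le γ hγ s hs hsξ q hq
        obtain ⟨η, hη, hξη⟩ := hD.isCofinal ξ
        obtain ⟨ε, hε⟩ := exists_isNext hη (lt_of_le_of_ne hξη fun h => hξD (h ▸ hη))
        obtain ⟨t, h1, h2, h3, h4, h5⟩ := (hgood ε).surj s' hs'.1 ξ hε.2.1 hs'ξ q hs'q n
        refine ⟨t, mem_uniformPart_of_gap hT hD hgood hs' h1 h3.le fun η hη h => ?_, h2,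
          hss'.trans_lt h3, h4, ?_⟩
        · exact h2.trans_le (hgap η hη (hγs'.trans_lt h))
        · rw [treeColor_of_notMem C (h2 ▸ hξD) (h2 ▸ hε), h5]
    intro s hs hsα r hr
    by_cases hacc : IsAcc D α
    · let α' : LimOmega1 := ⟨α, hacc.isSuccLimit fun h => h.not_lt hsα⟩
      obtain ⟨t, h1, h2, rfl, h4, h5⟩ := exists_branch C α' (isLowerSet_uniformPart hT)
        (P := (treeColor C D g T · = g α')) (fun ξ hξ u hu huξ q hq =>
          hcol ξ (C.lt_of_mem α' ξ hξ) u hu huξ q hq (g α')) hs hsα hr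
      have hle : ∀ β : LimOmega1, β.1 ≤ α → AlmostAll C t β (treeColor C D g T · = g β) := by
        intro β hβ
        rcases hβ.eq_or_lt with h | h
        · obtain rfl : β = α' := Subtype.ext h
          exact h5
        · obtain ⟨u, hu, huβ⟩ := exists_lt_ht_eq (h.trans_eq h1.symm)
          exact (almostAll_congr C hu.le huβ.ge _).1 ((h4 u hu).2 β huβ.ge)
      -- The branch gives a point `t` that may be missing from `T`; the requirement supplies a
      -- substitute.
      obtain ⟨t', h1', h2', h3', h4', h5'⟩ := hreq α' hacc s t h2 h1 (fun u hu => (h4 u hu).1) hle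
      exact ⟨t', ⟨h1', fun β hβ => h5' β (hβ.trans h2'.le)⟩, h2', h3', h4'⟩
    · rw [IsAcc] at hacc
      push Not at hacc
      obtain ⟨γ, hγ, hgap⟩ := hacc
      obtain ⟨s', hs', hss', hγs', hs'α, hs'r⟩ := hpre α le_rfl γ hγ s hs hsα r hr
      obtain ⟨t, h1, h2, h3, h4⟩ := hext α s' hs'.1 hs'α r hs'r
      refine ⟨t, mem_uniformPart_of_gap hT hD hgood hs' h1 h3.le fun η hη h => ?_, h2,
        hss'.trans_lt h3, h4⟩
      exact h2.trans_le (hgap η hη (hγs'.trans_lt h))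

end Uniformization

/-! ### Coding colourings by sets of ordinals -/

/-- The colouring coded by the set `X`. -/
noncomputable def decode (X : Set Omega1) (β : LimOmega1) : ℕ :=
  sInf {n | β.1.addNat n ∈ X}

theorem decode_inter {X : Set Omega1} {α : Omega1} (hα : Order.IsSuccLimit α) {β : LimOmega1}
    (hβ : β.1 < α) : decode (X ∩ Set.Iio α) β = decode X β :=
  congrArg sInf (Set.ext fun n => ⟨fun h => h.1, fun h => ⟨h, Omega1.addNat_lt hα hβ n⟩⟩)

theorem exists_decode_eq (g : LimOmega1 → ℕ) : ∃ X, decode X = g := by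
  refine ⟨{x | ∃ β : LimOmega1, x = β.1.addNat (g β)}, funext fun β => ?_⟩
  have : {n | β.1.addNat n ∈ {x | ∃ β : LimOmega1, x = β.1.addNat (g β)}} = {g β} := by
    ext n
    constructor
    · rintro ⟨β', h⟩
      obtain rfl := Omega1.addNat_inj β.2 β'.2 h
      have h := congrArg Subtype.val h
      have hβ : β = β' := Subtype.ext (Subtype.ext (Ordinal.add_right_cancel _ |>.1 h))
      rw [Set.mem_singleton_iff, hβ]
    · rintro rfl
      exact ⟨β, rfl⟩
  rw [decode, this, csInf_singleton]

/-- The requirements given by a sequence of guesses. -/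
def guesses (C : LadderSystem) (W : Omega1 → Set (Set Omega1)) (α : Omega1)
    (U : Set SigmaPrimeQ) : Set (Set SigmaPrimeQ) :=
  insert Set.univ
    {Q | ∃ A ∈ W α, ∃ B ∈ W α, ∃ n, Q = requirement C α U B (decode A) n}

theorem countable_guesses (C : LadderSystem) {W : Omega1 → Set (Set Omega1)}
    (hW : ∀ α, (W α).Countable) (α : Omega1) (U : Set SigmaPrimeQ) :
    (guesses C W α U).Countable := by
  have := (hW α).to_subtype
  refine ((Set.countable_range fun x : W α × W α × ℕ =>
    requirement C α U x.2.1 (decode x.1) x.2.2).mono ?_).insert _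
  rintro Q ⟨A, hA, B, hB, n, rfl⟩
  exact ⟨(⟨A, hA⟩, ⟨B, hB⟩, n), rfl⟩

/-- As `α` lies in `D`, the traces of `X` and `D` are both guessed, and by locality the guessed
requirement says the same as uniformization by the true colouring. It must also cover all `β < α`,
because predecessors of `t'` need not be those of `t`. -/
theorem exists_mem_reqTree_of_isAcc (C : LadderSystem) {W : Omega1 → Set (Set Omega1)}
    {X D : Set Omega1} (hD : IsClub D)
    (hX : ∀ α ∈ D, X ∩ Set.Iio α ∈ W α ∧ D ∩ Set.Iio α ∈ W α) (α : LimOmega1)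
    (hα : IsAcc D α.1) {s t : SigmaPrimeQ} (hst : s < t) (hht : ht t = α.1)
    (hpred : ∀ u < t, u ∈ reqTree (guesses C W))
    (h : ∀ β : LimOmega1, β.1 ≤ α.1 →
      AlmostAll C t β (treeColor C D (decode X) (reqTree (guesses C W)) · = decode X β)) :
    ∃ t' ∈ reqTree (guesses C W), ht t' = α.1 ∧ s < t' ∧ t'.max = t.max ∧
      ∀ β : LimOmega1, β.1 ≤ α.1 →
        AlmostAll C t' β (treeColor C D (decode X) (reqTree (guesses C W)) · = decode X β) := by
  set T := reqTree (guesses C W)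
  have hdec : ∀ β : LimOmega1, β.1 < α.1 → decode (X ∩ Set.Iio α.1) β = decode X β :=
    fun β hβ => decode_inter α.2 hβ
  have hcol : ∀ {u}, ht u < α.1 → treeColor C (D ∩ Set.Iio α.1) (decode (X ∩ Set.Iio α.1))
      {v ∈ T | ht v < α.1} u = treeColor C D (decode X) T u :=
    fun hu => treeColor_congr C hα hdec hu
  obtain ⟨hXα, hDα⟩ := hX _ (hα.mem hD α.2.not_isMin)
  have htQ : t ∈ requirement C α.1 {v ∈ T | ht v < α.1} (D ∩ Set.Iio α.1)
      (decode (X ∩ Set.Iio α.1)) (decode X α) := by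
    refine fun β => ⟨fun hβ => (h β hβ.le).mono fun u _ hu hc => ?_,
      fun hβ => (h β hβ.le).mono fun u _ hu hc => ?_⟩
    · rw [hcol (hu.trans hβ), hc, hdec β hβ]
    · obtain rfl : β = α := Subtype.ext hβ
      rw [hcol hu, hc]
  obtain ⟨t', h1, h2, h3, h4, h5⟩ := exists_mem_reqTree (guesses C W)
    (Or.inr ⟨_, hXα, _, hDα, _, rfl⟩) hst hht hpred htQ
  refine ⟨t', h1, h2, h3, h4, fun β hβ => ?_⟩
  rcases hβ.eq_or_lt with hβ' | hβ'
  · obtain rfl : β = α := Subtype.ext hβ'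
    exact ((h5 β).2 rfl).mono fun u _ hu hc => (hcol hu).symm.trans hc
  · refine ((h5 β).1 hβ').mono fun u _ hu hc => ?_
    rw [← hcol (hu.trans hβ'), hc, hdec β hβ']

theorem hasUniformization_of_exists {C : LadderSystem} {T : Set SigmaPrimeQ}
    (hT : IsLowerSet T) (hroot : ∃ s ∈ T, IsMin (ht s)) {D : Set Omega1} {g : LimOmega1 → ℕ}
    (hext : ∀ α, ∀ s ∈ uniformPart C D g T, ht s < α → ∀ r > s.max,
      ∃ t ∈ uniformPart C D g T, ht t = α ∧ s < t ∧ t.max = r)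
    {f : C.Colouring} (hf : ∀ α ξ, f α ξ = g α) : HasUniformization T f := by
  refine ⟨{t | t.1 ∈ uniformPart C D g T}, fun t => treeColor C D g T t.1.1, ⟨?_, ?_, ?_⟩, ?_⟩
  · obtain ⟨s, hs, hmin⟩ := hroot
    refine ⟨⟨s, hs⟩, hs, fun β hβ => ?_⟩
    exact absurd (hmin.mono hβ) β.2.not_isMin
  · exact fun s t hts hs => isLowerSet_uniformPart hT (show t.1 ≤ s.1 from hts) hs
  · intro s hs β hβ
    rcases le_or_gt ⟨β, hβ⟩ (ht s.1) with h | h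
    · exact ⟨s, hs, le_rfl, (height_coe hT s).symm ▸ h⟩
    · obtain ⟨t, h1, h2, h3, -⟩ := hext ⟨β, hβ⟩ s.1 hs h _ (lt_add_one _)
      refine ⟨⟨t, h1.1⟩, h1, h3.le, ?_⟩
      rw [← height_coe hT ⟨t, h1.1⟩]
      exact h2.ge
  · intro s α hα
    have hsα : ht s.1.1 = α.1 := Subtype.ext ((height_coe hT s.1).trans hα)
    refine Set.Finite.of_finite_image (f := Subtype.val)
      ((s.2.2 α hsα.ge).subset ?_) Subtype.val_injective.injOn
    rintro _ ⟨ξ, hξ, rfl⟩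
    refine ⟨ξ.2, ?_⟩
    obtain ⟨u, hus, hu⟩ := exists_lt_ht_eq ((C.lt_of_mem α ξ ξ.2).trans_eq hsα.symm)
    refine ⟨u, hus, hu, fun hc => hξ ?_⟩
    have huS : u ∈ uniformPart C D g T := isLowerSet_uniformPart hT hus.le s.2
    refine ⟨⟨⟨u, huS.1⟩, huS⟩, hus, ?_, hc.trans (hf α ξ).symm⟩
    exact (height_coe hT ⟨u, huS.1⟩).symm.trans (congrArg Subtype.val hu)

theorem DiamondPlus.exists_tree (h : DiamondPlus) (C : LadderSystem) :
    ∃ T : Set SigmaPrimeQ, IsSubtree T ∧ IsAronszajn T ∧ IsSpecial T ∧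
      ∀ f : C.Colouring, f.Monochromatic → HasUniformization T f := by
  obtain ⟨W, hW, hguess⟩ := h
  have huniv : ∀ α U, Set.univ ∈ guesses C W α U := fun _ _ => Set.mem_insert _ _
  have hcount : ∀ α (U : Set SigmaPrimeQ), U.Countable → (guesses C W α U).Countable :=
    fun α U _ => countable_guesses C hW α U
  refine ⟨reqTree (guesses C W), isSubtree_reqTree C huniv, isAronszajn_reqTree C huniv hcount,
    isSpecial_of_set _, fun f hf => ?_⟩
  choose g hg using hf
  obtain ⟨X, rfl⟩ := exists_decode_eq g
  obtain ⟨D, hD, hX⟩ := hguess X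
  have hext := exists_extension C huniv
  refine hasUniformization_of_exists (isLowerSet_reqTree _)
    ⟨_, mem_reqTree_of_isMin _ (ht_singleton 0), ht_singleton 0⟩
    (exists_mem_uniformPart (isLowerSet_reqTree _) hD (fun ε => ?_) hext
      fun α hα s t hst hht hpred h => exists_mem_reqTree_of_isAcc C hD hX α hα hst hht hpred h) hg
  -- `piece` is good because a good colouring exists.
  exact Classical.epsilon_spec
    (exists_isGood C (countable_reqTree_Iic hcount) hext ε (decode X))

end LadderUnif

theorem theorem6p1 (h : LadderUnif.DiamondPlus) (C : LadderUnif.LadderSystem) :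
    ∃ T : Set LadderUnif.SigmaPrimeQ, LadderUnif.IsSubtree T ∧
      LadderUnif.IsAronszajn T ∧ LadderUnif.IsSpecial T ∧
      ∀ f : C.Colouring, f.Monochromatic → LadderUnif.HasUniformization T f :=
  LadderUnif.DiamondPlus.exists_tree h C
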